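/- Let $M$ be a monoid that is left cancellative ($ab=ac \Rightarrow b=c$ for all $a,b,c\in M$) or right cancellative ($ba=ca \Rightarrow b=c$ for all $a,b,c\in M$). Suppose that the group of units $G$ of $M$ is amenable, that is, there is a finitely additive probability measure, defined on all subsets of $G$, that is invariant under left translation by elements of $G$. Then $M$ is (left) sofic: for every finite subset $K$ of $M$ and every real $\epsilon>0$ there exist a nonempty finite set $X$ and a map $M\times X\to X$, $(m,x)\mapsto m\cdot x$, such that - $1\cdot x=x$ for all $x\in X$; - for all $g,h\in K$, the proportion of elements $x\in X$ with $g\cdot(h\cdot x)=(gh)\cdot x$ is at least $1-\epsilon$; - for all $g,h\in K$ with $g\neq h$, the proportion of elements $x\in X$ with $g\cdot x=h\cdot x$ is at most $\epsilon$. -/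

import Mathlib

open scoped Pointwise

/-- A group `G` is amenable if it carries a finitely additive probability measure, defined on all
subsets of `G`, which is invariant under left translation. -/
def IsAmenableGroup (G : Type*) [Group G] : Prop :=
  ∃ μ : Set G → ℝ,
    (∀ A, 0 ≤ μ A) ∧
    μ Set.univ = 1 ∧
    (∀ A B, Disjoint A B → μ (A ∪ B) = μ A + μ B) ∧
    ∀ (g : G) (A : Set G), μ (g • A) = μ A

/-- The proportion of the elements of a (nonempty, finite) set `X` that satisfy `p`. -/
noncomputable def proportion {X : Type*} (p : X → Prop) : ℝ :=
  ({x | p x}.ncard : ℝ) / (Nat.card X : ℝ)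

/-- The map `M × X → X`, `(m, x) ↦ act m x`, is a (left) `(K, ε)`-action of the monoid `M` on the
finite set `X`. -/
structure IsApproxAction {M : Type*} [Monoid M] (K : Finset M) (ε : ℝ) {X : Type*}
    (act : M → X → X) : Prop where
  one_act : ∀ x, act 1 x = x
  act_act : ∀ g ∈ K, ∀ h ∈ K,
    1 - ε ≤ proportion fun x : X => act g (act h x) = act (g * h) x
  act_ne : ∀ g ∈ K, ∀ h ∈ K, g ≠ h →
    proportion (fun x : X => act g x = act h x) ≤ ε

/-- A monoid `M` is (left) sofic if for every finite subset `K` of `M` and every `ε > 0` there is a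
`(K, ε)`-action of `M` on some nonempty finite set. -/
def IsSoficMonoid (M : Type*) [Monoid M] : Prop :=
  ∀ (K : Finset M) (ε : ℝ), 0 < ε →
    ∃ (X : Type) (_ : Finite X) (_ : Nonempty X) (act : M → X → X), IsApproxAction K ε act

/-! One-sided cancellation makes every factor of a unit a unit. Let `A` be a Følner set of the unit
group. A unit `h` in `K` keeps most of `A` inside `A`; a nonunit `h` throws `A` into the nonunits,
and no further left multiplication leads back to a unit. So few elements leave `A` and return
(`isSoficMonoid_of_few_returns`). The approximate action lives on many copies of `A`, all sharing
one negligible set `B` that receives the products leaving `A`. -/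

/-! ### Følner sets from an invariant mean -/

/-- Left multiplication by a finite set cannot double the size of every finite subset of an amenable
group: by Hall's marriage theorem, doubling gives two disjoint copies of the group inside itself,
each obtained from the whole group by translating finitely many pieces. -/
theorem IsAmenableGroup.exists_card_mul_lt {G : Type*} [Group G] [DecidableEq G]
    (hG : IsAmenableGroup G) (T : Finset G) :
    ∃ A : Finset G, (T * A).card < 2 * A.card := by
  by_contra! hT
  obtain ⟨μ, hnonneg, huniv, hadd, hinv⟩ := hG
  have hempty : μ ∅ = 0 := by
    have := hadd ∅ ∅ (by simp)
    simp only [Set.union_empty] at this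
    linarith
  have hmono : ∀ A B : Set G, A ⊆ B → μ A ≤ μ B := by
    intro A B hAB
    have := hadd A (B \ A) Set.disjoint_sdiff_right
    rw [Set.union_sdiff_cancel hAB] at this
    linarith [hnonneg (B \ A)]
  have hsum : ∀ (S : Finset G) (P : G → Set G), (∀ s t, s ≠ t → Disjoint (P s) (P t)) →
      μ (⋃ s ∈ S, P s) = ∑ s ∈ S, μ (P s) := by
    intro S P hP
    induction S using Finset.induction_on with
    | empty => simpa using hempty
    | insert a S ha ih =>
      rw [Finset.set_biUnion_insert, hadd, ih, Finset.sum_insert ha]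
      refine Set.disjoint_iUnion₂_right.2 fun s hs => hP _ _ ?_
      rintro rfl
      exact ha hs
  obtain ⟨f, hf, hfmem⟩ := (Finset.all_card_le_biUnion_card_iff_exists_injective
      (fun p : G × Bool => T * {p.1})).1 (by
    intro s
    have hs : s ⊆ s.image Prod.fst ×ˢ Finset.univ := by
      intro p hp
      exact Finset.mem_product.2 ⟨Finset.mem_image_of_mem _ hp, Finset.mem_univ _⟩
    have hcard := Finset.card_le_card hs
    rw [Finset.card_product, Finset.card_univ, Fintype.card_bool] at hcard
    have hmul : T * s.image Prod.fst ⊆ s.biUnion fun p => T * {p.1} := by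
      intro x hx
      obtain ⟨t, ht, y, hy, rfl⟩ := Finset.mem_mul.1 hx
      obtain ⟨p, hp, rfl⟩ := Finset.mem_image.1 hy
      exact Finset.mem_biUnion.2 ⟨p, hp, Finset.mul_mem_mul ht (Finset.mem_singleton_self _)⟩
    have := hT (s.image Prod.fst)
    have := Finset.card_le_card hmul
    omega)
  have hrange : ∀ i : Bool, μ (Set.range fun x => f (x, i)) = 1 := by
    intro i
    -- Cut the domain by the translating element: each copy of `G` is then reassembled from
    -- translated pieces, so it has measure 1.
    let P : G → Set G := fun s => {x | f (x, i) = s * x}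
    have hP : ∀ s t, s ≠ t → Disjoint (P s) (P t) := by
      intro s t hst
      refine Set.disjoint_left.2 fun x hx hx' => hst ?_
      exact mul_right_cancel ((show f (x, i) = s * x from hx).symm.trans hx')
    have hcover : ∀ x, ∃ s ∈ T, f (x, i) = s * x := by
      intro x
      obtain ⟨s, hs, y, hy, h⟩ := Finset.mem_mul.1 (hfmem (x, i))
      rw [Finset.mem_singleton] at hy
      exact ⟨s, hs, by rw [← h, hy]⟩
    have himage : (Set.range fun x => f (x, i)) = ⋃ s ∈ T, s • P s := by
      ext y
      simp only [Set.mem_range, Set.mem_iUnion, Set.mem_smul_set, exists_prop, smul_eq_mul]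
      constructor
      · rintro ⟨x, rfl⟩
        obtain ⟨s, hs, h⟩ := hcover x
        exact ⟨s, hs, x, h, h.symm⟩
      · rintro ⟨s, -, x, h, rfl⟩
        exact ⟨x, h⟩
    have hunion : (⋃ s ∈ T, P s) = Set.univ := by
      refine Set.eq_univ_of_forall fun x => ?_
      obtain ⟨s, hs, h⟩ := hcover x
      exact Set.mem_biUnion hs h
    rw [himage, hsum T (fun s => s • P s), ← huniv, ← hunion, hsum T P hP]
    · exact Finset.sum_congr rfl fun s _ => hinv s _
    · intro s t hst
      refine Set.disjoint_left.2 ?_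
      rintro _ ⟨x, hx, rfl⟩ ⟨y, hy, hxy⟩
      simp only [smul_eq_mul] at hxy
      have hfx : f (x, i) = s * x := hx
      have hfy : f (y, i) = t * y := hy
      have : (y, i) = (x, i) := hf (by rw [hfx, hfy, hxy])
      obtain rfl : y = x := congrArg Prod.fst this
      exact hst (mul_right_cancel hxy).symm
  have hdisj : Disjoint (Set.range fun x => f (x, true)) (Set.range fun x => f (x, false)) := by
    refine Set.disjoint_left.2 ?_
    rintro _ ⟨x, rfl⟩ ⟨y, h⟩
    simpa using hf h
  have h1 := hadd _ _ hdisj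
  have h2 := hmono _ _ (Set.subset_univ
    ((Set.range fun x => f (x, true)) ∪ Set.range fun x => f (x, false)))
  rw [hrange, hrange] at h1
  linarith

/-- Følner's condition for amenable groups. -/
theorem IsAmenableGroup.exists_foelner {G : Type*} [Group G] [DecidableEq G]
    (hG : IsAmenableGroup G) (K : Finset G) {δ : ℝ} (hδ : 0 < δ) :
    ∃ A : Finset G, A.Nonempty ∧ ∀ h ∈ K, ((A.filter fun a => h * a ∉ A).card : ℝ) ≤ δ * A.card := by
  by_contra! hK
  let S := insert 1 K
  -- Without Følner sets, multiplying by `S` always enlarges by the factor `1 + δ`; a power of `S`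
  -- would then double every finite set.
  have hgrow : ∀ A : Finset G, (1 + δ) * A.card ≤ ((S * A).card : ℝ) := by
    intro A
    rcases A.eq_empty_or_nonempty with rfl | hA
    · simp
    obtain ⟨h, hh, hlt⟩ := hK A hA
    have hdisj : Disjoint A ((A.filter fun a => h * a ∉ A).image (h * ·)) := by
      refine Finset.disjoint_left.2 fun x hx hx' => ?_
      obtain ⟨a, ha, rfl⟩ := Finset.mem_image.1 hx'
      exact (Finset.mem_filter.1 ha).2 hx
    have hsub : A ∪ (A.filter fun a => h * a ∉ A).image (h * ·) ⊆ S * A := by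
      refine Finset.union_subset (fun x hx => ?_) fun x hx => ?_
      · simpa using Finset.mul_mem_mul (Finset.mem_insert_self 1 K) hx
      · obtain ⟨a, ha, rfl⟩ := Finset.mem_image.1 hx
        exact Finset.mul_mem_mul (Finset.mem_insert_of_mem hh) (Finset.mem_filter.1 ha).1
    have hcard := Finset.card_le_card hsub
    rw [Finset.card_union_of_disjoint hdisj,
      Finset.card_image_of_injective _ (mul_right_injective h)] at hcard
    have : (A.card : ℝ) + (A.filter fun a => h * a ∉ A).card ≤ (S * A).card := by
      exact_mod_cast hcard
    linarith
  have hpow : ∀ (n : ℕ) (A : Finset G), (1 + δ) ^ n * A.card ≤ ((S ^ n * A).card : ℝ) := by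
    intro n
    induction n with
    | zero => simp
    | succ n ih =>
      intro A
      calc (1 + δ) ^ (n + 1) * A.card = (1 + δ) ^ n * ((1 + δ) * A.card) := by ring
        _ ≤ (1 + δ) ^ n * (S * A).card := by
          gcongr
          exact hgrow A
        _ ≤ ((S ^ n * (S * A)).card : ℝ) := ih _
        _ = ((S ^ (n + 1) * A).card : ℝ) := by rw [pow_succ, mul_assoc]
  obtain ⟨n, hn⟩ := pow_unbounded_of_one_lt 2 (show 1 < 1 + δ by linarith)
  obtain ⟨A, hA⟩ := hG.exists_card_mul_lt (S ^ n)
  have hA' : ((S ^ n * A).card : ℝ) < 2 * A.card := by exact_mod_cast hA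
  have : 2 * (A.card : ℝ) ≤ (1 + δ) ^ n * A.card := by gcongr
  linarith [hpow n A]

/-! ### From few returns to approximate actions -/

theorem proportion_comp_equiv {X Y : Type*} (e : X ≃ Y) (p : Y → Prop) :
    proportion (fun x => p (e x)) = proportion p := by
  have h : {x | p (e x)}.ncard = {y | p y}.ncard :=
    Nat.card_congr (e.subtypeEquiv fun _ => Iff.rfl)
  rw [proportion, proportion, h, Nat.card_congr e]

theorem IsApproxAction.congr {M : Type*} [Monoid M] {K : Finset M} {ε : ℝ} {X Y : Type*}
    {act : M → X → X} (h : IsApproxAction K ε act) (e : Y ≃ X) :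
    IsApproxAction K ε fun m y => e.symm (act m (e y)) where
  one_act y := by simp [h.one_act]
  act_act g hg k hk := by
    simpa [proportion_comp_equiv e fun x => act g (act k x) = act (g * k) x]
      using h.act_act g hg k hk
  act_ne g hg k hk hne := by
    simpa [proportion_comp_equiv e fun x => act g x = act k x] using h.act_ne g hg k hk hne

theorem proportion_le {X : Type*} [Finite X] [Nonempty X] {p : X → Prop} {ε : ℝ} {s : Set X}
    (hp : ∀ x, p x → x ∈ s) (hs : (s.ncard : ℝ) ≤ ε * Nat.card X) : proportion p ≤ ε := by
  rw [proportion, div_le_iff₀ (by exact_mod_cast Nat.card_pos)]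
  exact le_trans (by exact_mod_cast Set.ncard_le_ncard (t := s) hp) hs

theorem le_proportion {X : Type*} [Finite X] [Nonempty X] {p : X → Prop} {ε : ℝ} {s : Set X}
    (hp : ∀ x, x ∉ s → p x) (hs : (s.ncard : ℝ) ≤ ε * Nat.card X) : 1 - ε ≤ proportion p := by
  rw [proportion, le_div_iff₀ (by exact_mod_cast Nat.card_pos)]
  have h1 : (s.ncard : ℝ) + sᶜ.ncard = Nat.card X := by exact_mod_cast Set.ncard_add_ncard_compl s
  have h2 : (sᶜ.ncard : ℝ) ≤ {x | p x}.ncard := by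
    exact_mod_cast Set.ncard_le_ncard (t := {x | p x}) hp
  linarith

open Classical in
/-- Left multiplication on many copies of `A` and one copy of `B`, where a product that leaves its
copy of `A` is looked up in `B`, and a product that is not represented leaves the point fixed. -/
noncomputable def copiesAct {M : Type*} [Monoid M] (A B : Finset M) (N : ℕ) (m : M) :
    (A × Fin N) ⊕ B → (A × Fin N) ⊕ B
  | .inl (a, i) =>
    if hA : m * a ∈ A then .inl (⟨m * a, hA⟩, i)
    else if hB : m * a ∈ B then .inr ⟨m * a, hB⟩ else .inl (a, i)
  | .inr b => if hB : m * b ∈ B then .inr ⟨m * b, hB⟩ else .inr b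

/-- A monoid is sofic if it has finite subsets `A`, whose elements can be cancelled on the right,
such that few elements of `A` leave `A` and come back under successive multiplication by two given
elements. -/
theorem isSoficMonoid_of_few_returns {M : Type*} [Monoid M] [DecidableEq M]
    (H : ∀ (K : Finset M) (δ : ℝ), 0 < δ → ∃ A : Finset M, A.Nonempty ∧
      (∀ a ∈ A, IsRightRegular a) ∧
      ∀ g ∈ K, ∀ h ∈ K,
        ((A.filter fun a => h * a ∉ A ∧ g * (h * a) ∈ A).card : ℝ) ≤ δ * A.card) :
    IsSoficMonoid M := by
  intro K ε hε
  obtain ⟨A, hA, hreg, hret⟩ := H K (ε / 2) (by positivity)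
  let B : Finset M := K * A ∪ K * (K * A)
  -- With this many copies, `B` fills at most `ε / 2` of `X`, so all of it may count as bad; the
  -- other `ε / 2` is for the returns.
  obtain ⟨N, hN⟩ := exists_nat_gt ((B.card : ℝ) / (ε / 2))
  rw [div_lt_iff₀ (by positivity)] at hN
  have hNpos : 0 < N := by
    rcases Nat.eq_zero_or_pos N with rfl | h
    · simp only [CharP.cast_eq_zero, zero_mul] at hN
      exact absurd hN (not_lt.2 (Nat.cast_nonneg _))
    · exact h
  let X := (A × Fin N) ⊕ B
  have : Nonempty X := ⟨.inl (⟨_, hA.choose_spec⟩, ⟨0, hNpos⟩)⟩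
  have hXcard : (Nat.card X : ℝ) = A.card * N + B.card := by simp [X]
  have hApos : (1 : ℝ) ≤ A.card := by exact_mod_cast hA.card_pos
  have hcount : ∀ P : M → Prop, [DecidablePred P] →
      ((A.filter P).card : ℝ) ≤ ε / 2 * A.card →
      (({x : X | ∀ a i, x = .inl (a, i) → P a}).ncard : ℝ) ≤ ε * Nat.card X := by
    intro P _ hP
    have hsub : {x : X | ∀ a i, x = .inl (a, i) → P a} ⊆
        Sum.inl '' ({a : A | P a} ×ˢ (Set.univ : Set (Fin N))) ∪ Sum.inr '' Set.univ := by
      rintro (⟨a, i⟩ | b) hx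
      · exact Or.inl ⟨(a, i), ⟨hx a i rfl, trivial⟩, rfl⟩
      · exact Or.inr ⟨b, trivial, rfl⟩
    have hPcard : {a : A | P a}.ncard = (A.filter P).card := by
      rw [← Set.ncard_image_of_injective _ Subtype.val_injective, ← Set.ncard_coe_finset]
      congr 1
      ext x
      simp [and_comm]
    have hle : {x : X | ∀ a i, x = .inl (a, i) → P a}.ncard ≤ (A.filter P).card * N + B.card := by
      refine (Set.ncard_le_ncard hsub).trans ((Set.ncard_union_le _ _).trans ?_)
      rw [Set.ncard_image_of_injective _ Sum.inl_injective,
        Set.ncard_image_of_injective _ Sum.inr_injective, Set.ncard_prod, hPcard]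
      simp
    have hle' : (({x : X | ∀ a i, x = .inl (a, i) → P a}).ncard : ℝ) ≤
        (A.filter P).card * N + B.card := by exact_mod_cast hle
    have h1 : ((A.filter P).card : ℝ) * N ≤ ε / 2 * A.card * N := by gcongr
    have h2 : (N : ℝ) * (ε / 2) ≤ A.card * (N * (ε / 2)) :=
      le_mul_of_one_le_left (by positivity) hApos
    have h3 : 0 ≤ ε * (B.card : ℝ) := by positivity
    rw [hXcard]
    linarith
  have hB₁ : ∀ h ∈ K, ∀ a ∈ A, h * a ∈ B := fun h hh a ha =>
    Finset.mem_union_left _ (Finset.mul_mem_mul hh ha)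
  have hB₂ : ∀ g ∈ K, ∀ h ∈ K, ∀ a ∈ A, g * (h * a) ∈ B := fun g hg h hh a ha =>
    Finset.mem_union_right _ (Finset.mul_mem_mul hg (Finset.mul_mem_mul hh ha))
  have hact : IsApproxAction K ε (copiesAct A B N) := by
    refine ⟨?_, fun g hg h hh => ?_, fun g hg h hh hne => ?_⟩
    · rintro (⟨a, i⟩ | b) <;> simp [copiesAct]
    · refine le_proportion ?_ (hcount _ (hret g hg h hh))
      rintro (⟨a, i⟩ | b) hx
      swap
      · exact absurd (fun _ _ h => nomatch h) hx
      have h1 := hB₁ h hh a a.2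
      have h2 := hB₂ g hg h hh a a.2
      -- Once in `B`, a point stays in `B`, whereas `(g * h) * a` is looked up in `A` first: the two
      -- sides differ only at a return.
      by_cases hhA : h * (a : M) ∈ A
      · by_cases hgA : g * (h * (a : M)) ∈ A <;>
          simp [copiesAct, hhA, hgA, h2, mul_assoc]
      · have hgA : g * (h * (a : M)) ∉ A := fun hgA => hx fun _ _ h => by
          cases h
          exact ⟨hhA, hgA⟩
        simp [copiesAct, hhA, hgA, h1, h2, mul_assoc]
    · refine proportion_le ?_ (hcount (fun _ => False) (by simp; positivity))
      rintro x hx a i rfl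
      have h1 := hB₁ g hg a a.2
      have h2 := hB₁ h hh a a.2
      have : g * (a : M) = h * a := by
        revert hx
        by_cases hgA : g * (a : M) ∈ A <;> by_cases hhA : h * (a : M) ∈ A <;>
          simp [copiesAct, hgA, hhA, h1, h2]
      exact hne (hreg a a.2 this)
  -- `X` lives in the universe of `M`; soficity asks for a set in `Type`.
  let e : Fin (Nat.card X) ≃ X := (Finite.equivFin X).symm
  exact ⟨Fin (Nat.card X), inferInstance, ⟨e.symm (Classical.arbitrary X)⟩, _, hact.congr e⟩

/-! ### One-sided cancellative monoids -/

theorem corollary3p3 (M : Type*) [Monoid M]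
    (hcancel : IsLeftCancelMul M ∨ IsRightCancelMul M)
    (hunits : IsAmenableGroup Mˣ) :
    IsSoficMonoid M := by
  classical
  -- If `a * b = 1`, then `a * (b * a) = a` and `(b * a) * b = b`; cancelling in either one gives `b
  -- * a = 1`.
  have : IsDedekindFiniteMonoid M := by rcases hcancel with _ | _ <;> infer_instance
  refine isSoficMonoid_of_few_returns fun K δ hδ => ?_
  obtain ⟨F, hF, hfol⟩ := hunits.exists_foelner
    (K.preimage Units.val Units.val_injective.injOn) hδ
  refine ⟨F.image Units.val, hF.image _, ?_, fun g _ h hh => ?_⟩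
  · intro a ha
    obtain ⟨u, -, rfl⟩ := Finset.mem_image.1 ha
    exact u.isUnit.isRegular.right
  rw [Finset.card_image_of_injective _ Units.val_injective]
  by_cases hu : IsUnit h
  · obtain ⟨u, rfl⟩ := hu
    refine le_trans ?_ (hfol u (Finset.mem_preimage.2 hh))
    rw [← Finset.card_image_of_injective (F.filter _) Units.val_injective]
    refine Nat.cast_le.2 (Finset.card_le_card fun x hx => ?_)
    obtain ⟨hx, hux, -⟩ := Finset.mem_filter.1 hx
    obtain ⟨v, hv, rfl⟩ := Finset.mem_image.1 hx
    refine Finset.mem_image_of_mem _ (Finset.mem_filter.2 ⟨hv, fun huv => hux ?_⟩)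
    exact Finset.mem_image.2 ⟨u * v, huv, rfl⟩
  · rw [Finset.filter_eq_empty_iff.2, Finset.card_empty, Nat.cast_zero]
    · positivity
    rintro x hx ⟨-, hgx⟩
    obtain ⟨v, -, rfl⟩ := Finset.mem_image.1 hx
    obtain ⟨w, -, hw⟩ := Finset.mem_image.1 hgx
    have hprod : IsUnit (g * (h * (v : M))) := hw ▸ w.isUnit
    exact hu ((Units.isUnit_mul_units h v).1 (isUnit_of_mul_isUnit_right hprod))
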